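/- Bounded Set Theory $\mathrm{BST}$ is formulated in the language with $\in$ and a unary predicate $\operatorname{st}$ ("is standard"); $\in$-formulas are the formulas without $\operatorname{st}$, and superscripts such as $\forall^{\operatorname{st}}$ restrict quantifiers to standard sets. Its axioms are those of $\mathrm{ZFC}$ (Separation and Replacement for $\in$-formulas only) together with: * Boundedness: $\forall x\,\exists^{\operatorname{st}} y\,(x\in y)$. * Transfer: $\forall^{\operatorname{st}}x\,\phi(x)\to\forall x\,\phi(x)$ for every $\in$-formula $\phi$ with standard parameters. * Standardization: $\forall A\,\exists^{\operatorname{st}}S\,\forall^{\operatorname{st}}x\,(x\in S\leftrightarrow x\in A\wedge\phi(x))$ for every formula $\phi$ of the full language with arbitrary parameters. * Bounded Idealization: for every standard $A$ and every $\in$-formula $\phi$ with arbitrary parameters, $\big(\forall a\subseteq A$ standard and finite $\exists y\,\forall x\in a\;\phi(x,y)\big)\leftrightarrow\exists y\,\forall^{\operatorname{st}}x\in A\;\phi(x,y)$. Work in $\mathrm{BST}$ (equivalently, in an arbitrary model of $\mathrm{BST}$). Let $I$ be a standard set and $w\in I$. A set $x$ is *$w$-standard*, $\operatorname{st}_w(x)$,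 if $x=f(w)$ for some standard function $f$ with domain $I$. Let $\mathbf S$ be the class of standard sets and $\mathbf S_w$ the class of $w$-standard sets. The set $w$ is *good* if some $\nu\in\mathbb N$ is $w$-standard but not standard. Then the following hold. 1. (Transfer from $w$-standard sets) For every $\in$-formula $\phi$ with $w$-standard parameters, $\forall^{\operatorname{st}_w}x\,\phi(x)\to\forall x\,\phi(x)$. 2. (Countable Idealization into $w$-standard sets) If $w$ is good, then for every $\in$-formula $\phi$ with $w$-standard parameters, $$\forall^{\operatorname{st}}n\in\mathbb N\;\exists x\;\forall m\in\mathbb N\,(m\le n\to\phi(m,x))\;\longleftrightarrow\;\exists^{\operatorname{st}_w}x\;\forall^{\operatorname{st}}n\in\mathbb N\;\phi(n,x).$$ In other words, $(\mathbf S_w,\mathbf S,\in)$ satisfies Countable Idealization: interpreted in $\mathbf S_w$ (with $\mathbf S$ as the class of standard sets), for every $\in$-formula $\phi$ with parameters in $\mathbf S_w$, $$\forall^{\operatorname{st}}n\in\mathbb N\;\exists x\;\forall m\in\mathbb N\,(m\le n\to\phi(m,x))\;\longleftrightarrow\;\exists x\;\forall^{\operatorname{st}}n\in\mathbb N\;\phi(n,x).$$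 3. (Representability) Let $\phi(v)$ be an $\in$-formula with standard parameters. If $J$ is any standard set with $w\in J$, $x$ is $w$-standard, and $\phi(x)$ holds, then there is a standard function $f$ with $\operatorname{dom}f=J$ such that $x=f(w)$ and $\phi(f(i))$ holds for all $i\in J$. -/

import Mathlib

open FirstOrder

namespace BST

/-- The only symbol of the `∈`-language, a binary relation symbol. -/
inductive MemSymbol : ℕ → Type
  | mem : MemSymbol 2

/-- The symbols of the `st`-`∈`-language: binary membership and the unary predicate `st`. -/
inductive StMemSymbol : ℕ → Type
  | mem : StMemSymbol 2
  | st : StMemSymbol 1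

/-- The `∈`-language (equality is a logical symbol). -/
def memLang : Language := ⟨fun _ => Empty, MemSymbol⟩

/-- The `st`-`∈`-language (equality is a logical symbol). -/
def stMemLang : Language := ⟨fun _ => Empty, StMemSymbol⟩

/-- The data of a structure for the `st`-`∈`-language. -/
class StMem (M : Type*) where
  mem : M → M → Prop
  st : M → Prop

infix:50 " ∊ " => StMem.mem

instance memStructure (M : Type*) [StMem M] : memLang.Structure M where
  funMap := fun f => f.elim
  RelMap := fun r v => match r, v with
    | MemSymbol.mem, v => v 0 ∊ v 1

instance stMemStructure (M : Type*) [StMem M] : stMemLang.Structure M where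
  funMap := fun f => f.elim
  RelMap := fun r v => match r, v with
    | StMemSymbol.mem, v => v 0 ∊ v 1
    | StMemSymbol.st, v => StMem.st (v 0)

/-- An `∈`-formula with parameters among `p 0, …, p (k - 1)` is given by a formula
`φ : MemFormula k n` together with `p : Fin k → M`; it has `n` further free variables. Its truth
at `x : Fin n → M` is `φ.Realize p x`. -/
abbrev MemFormula (k n : ℕ) := memLang.BoundedFormula (Fin k) n

/-- The same for the `st`-`∈`-language. -/
abbrev StMemFormula (k n : ℕ) := stMemLang.BoundedFormula (Fin k) n

section SetTheory

variable {M : Type*} [StMem M]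

/-- `x ⊆ y` -/
def IsSub (x y : M) : Prop := ∀ z, z ∊ x → z ∊ y

/-- `x = ∅` -/
def IsEmptySet (x : M) : Prop := ∀ z, ¬ z ∊ x

/-- `c = {a, b}` -/
def IsUPair (a b c : M) : Prop := ∀ z, z ∊ c ↔ z = a ∨ z = b

/-- `c = ⟨a, b⟩ = {{a}, {a, b}}` -/
def IsPair (a b c : M) : Prop := ∀ z, z ∊ c ↔ IsUPair a a z ∨ IsUPair a b z

/-- `⟨a, b⟩ ∈ f`; if `f` is a function this says that `a ∈ dom f` and `f(a) = b`. -/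
def MapsTo (f a b : M) : Prop := ∃ c, c ∊ f ∧ IsPair a b c

/-- `f` is a function with domain `A`. -/
def IsFunOn (f A : M) : Prop :=
  (∀ c, c ∊ f → ∃ a b, a ∊ A ∧ IsPair a b c) ∧ ∀ a, a ∊ A → ∃! b, MapsTo f a b

/-- `f` is a bijection of `A` onto `B`. -/
def IsBij (f A B : M) : Prop :=
  IsFunOn f A ∧ (∀ a b, MapsTo f a b → b ∊ B) ∧ ∀ b, b ∊ B → ∃! a, MapsTo f a b

/-- `y = x ∪ {x}` -/
def IsSucc (x y : M) : Prop := ∀ z, z ∊ y ↔ z ∊ x ∨ z = x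

/-- `∅ ∈ J`, and `x ∪ {x} ∈ J` for every `x ∈ J`. -/
def IsInductive (J : M) : Prop :=
  (∃ e, IsEmptySet e ∧ e ∊ J) ∧ ∀ x, x ∊ J → ∃ y, IsSucc x y ∧ y ∊ J

/-- `n ∈ ℕ`, where `ℕ = ω` is the least inductive set. -/
def IsNat (n : M) : Prop := ∀ J, IsInductive J → n ∊ J

/-- `m ≤ n` for von Neumann natural numbers. -/
def NatLE (m n : M) : Prop := m ∊ n ∨ m = n

/-- `a` is finite, i.e. in bijection with a natural number. -/
def IsFiniteSet (a : M) : Prop := ∃ n f, IsNat n ∧ IsBij f n a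

end SetTheory

/-- `(M, ∈)` is a model of `ZFC`; Separation and Replacement are for `∈`-formulas. -/
structure IsZFC (M : Type*) [StMem M] : Prop where
  extensionality : ∀ x y : M, (∀ z, z ∊ x ↔ z ∊ y) → x = y
  foundation : ∀ x : M, (∃ y, y ∊ x) → ∃ y, y ∊ x ∧ ∀ z, z ∊ x → ¬ z ∊ y
  pairing : ∀ a b : M, ∃ c, IsUPair a b c
  union : ∀ x : M, ∃ u, ∀ z, z ∊ u ↔ ∃ y, y ∊ x ∧ z ∊ y
  powerset : ∀ x : M, ∃ u, ∀ z, z ∊ u ↔ IsSub z x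
  infinity : ∃ J : M, IsInductive J
  separation : ∀ (k : ℕ) (φ : MemFormula k 1) (p : Fin k → M) (A : M),
    ∃ B : M, ∀ x, x ∊ B ↔ x ∊ A ∧ φ.Realize p ![x]
  replacement : ∀ (k : ℕ) (φ : MemFormula k 2) (p : Fin k → M) (A : M),
    (∀ x, x ∊ A → ∀ y z, φ.Realize p ![x, y] → φ.Realize p ![x, z] → y = z) →
    ∃ B : M, ∀ y, y ∊ B ↔ ∃ x, x ∊ A ∧ φ.Realize p ![x, y]
  choice : ∀ A : M, (∀ x, x ∊ A → ∃ y, y ∊ x) →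
    ∃ f, IsFunOn f A ∧ ∀ x y, MapsTo f x y → y ∊ x

/-- `(M, st, ∈)` is a model of Bounded Set Theory. -/
structure IsBST (M : Type*) [StMem M] : Prop extends IsZFC M where
  boundedness : ∀ x : M, ∃ y, StMem.st y ∧ x ∊ y
  transfer : ∀ (k : ℕ) (φ : MemFormula k 1) (p : Fin k → M), (∀ j, StMem.st (p j)) →
    (∀ x : M, StMem.st x → φ.Realize p ![x]) → ∀ x : M, φ.Realize p ![x]
  standardization : ∀ (k : ℕ) (φ : StMemFormula k 1) (p : Fin k → M) (A : M),
    ∃ S : M, StMem.st S ∧ ∀ x, StMem.st x → (x ∊ S ↔ x ∊ A ∧ φ.Realize p ![x])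
  boundedIdealization : ∀ (k : ℕ) (φ : MemFormula k 2) (p : Fin k → M) (A : M), StMem.st A →
    ((∀ a : M, StMem.st a → IsFiniteSet a → IsSub a A →
        ∃ y, ∀ x, x ∊ a → φ.Realize p ![x, y]) ↔
      ∃ y : M, ∀ x, StMem.st x → x ∊ A → φ.Realize p ![x, y])

/-- `st_w(x)`: `x = f(w)` for some standard function `f` with domain `I`. It is used for standard
`I` with `w ∈ I`. -/
def WStandard {M : Type*} [StMem M] (I w x : M) : Prop :=
  ∃ f, StMem.st f ∧ IsFunOn f I ∧ MapsTo f w x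

/-- `w` is good: some natural number is `w`-standard but not standard. -/
def IsGood {M : Type*} [StMem M] (I w : M) : Prop :=
  ∃ ν, IsNat ν ∧ WStandard I w ν ∧ ¬ StMem.st ν

/-- The universe `S_w` of all `w`-standard sets. -/
def SubUniverse {M : Type*} [StMem M] (I w : M) : Type _ := {x : M // WStandard I w x}

/-- The structure `(S_w, S, ∈)`: membership and standardness are inherited. -/
instance {M : Type*} [StMem M] (I w : M) : StMem (SubUniverse I w) where
  mem x y := x.1 ∊ y.1
  st x := StMem.st x.1

/-- The structure `(M, st, ∈)` satisfies Countable Idealization, for all `∈`-formulas with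
parameters in `M`. -/
def CountableIdealization (M : Type*) [StMem M] : Prop :=
  ∀ (k : ℕ) (φ : MemFormula k 2) (p : Fin k → M),
    (∀ n : M, StMem.st n → IsNat n →
      ∃ x, ∀ m, IsNat m → NatLE m n → φ.Realize p ![m, x]) ↔
    ∃ x : M, ∀ n, StMem.st n → IsNat n → φ.Realize p ![n, x]

end BST

namespace BST

/-! Everything rests on `exists_wStandard`: a nonempty class defined by an `∈`-formula with
`w`-standard parameters `f j (w)` has a `w`-standard member. Boundedness puts some member into a
standard `Y`. Replacing each parameter by `f j (i)` gives a relation between `i` and points of `Y`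
with standard parameters only, and a standard choice function for it, evaluated at `w`, is the
member sought. This is the Tarski–Vaught test, so it yields both Transfer and the elementarity of
the `w`-standard universe.

For Countable Idealization, `exists_optimal` uses induction inside ZFC to find, for any natural `ν`,
one `x` that works on every initial segment up to `ν` on which anything works. If `ν` is
`w`-standard, so can `x` be; if `ν` is nonstandard, every standard natural lies below it
(`st_of_mem_nat`), so `x` serves them all. Elementarity then carries this into the `w`-standard
universe.

For Representability, a standard function is corrected by a standard constant wherever it is
undefined or violates the formula. -/

/-- The membership symbol. -/
def memRel : memLang.Relations 2 := MemSymbol.mem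

/-! ### Definable predicates, with control of the parameters -/

section Definability

variable {M : Type*} {A : Set M} {γ : Type*}

/-- `t` is a variable or a parameter from `A`. -/
def IsTerm (A : Set M) (t : (γ → M) → M) : Prop :=
  ∃ s : A ⊕ γ, ∀ v, t v = Sum.elim Subtype.val v s

namespace IsTerm

theorem var (i : γ) : IsTerm A (fun v => v i) := ⟨Sum.inr i, fun _ => rfl⟩

theorem const {a : M} (ha : a ∈ A) : IsTerm A (fun _ : γ → M => a) :=
  ⟨Sum.inl ⟨a, ha⟩, fun _ => rfl⟩

end IsTerm

variable [StMem M]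

/-- `P` is defined by an `∈`-formula with parameters from `A`. -/
def Def (A : Set M) (P : (γ → M) → Prop) : Prop :=
  ∃ φ : memLang.Formula (A ⊕ γ), ∀ v, P v ↔ φ.Realize (Sum.elim Subtype.val v)

namespace Def

variable {P Q : (γ → M) → Prop}

theorem congr (h : Def A P) (e : ∀ v, Q v ↔ P v) : Def A Q :=
  let ⟨φ, hφ⟩ := h
  ⟨φ, fun v => (e v).trans (hφ v)⟩

/-- Without function symbols, a term is a variable or a parameter, so substitution only relabels
free variables. -/
theorem subst {δ : Type*} {P : (δ → M) → Prop} (h : Def A P) {t : δ → (γ → M) → M}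
    (ht : ∀ d, IsTerm A (t d)) : Def A (fun v => P (fun d => t d v)) := by
  obtain ⟨φ, hφ⟩ := h
  choose s hs using ht
  refine ⟨φ.relabel (Sum.elim Sum.inl s), fun v => ?_⟩
  rw [Language.Formula.realize_relabel]
  refine (hφ _).trans ?_
  have : Sum.elim Subtype.val (fun d => t d v)
      = Sum.elim Subtype.val v ∘ Sum.elim (Sum.inl : A → A ⊕ γ) s := by
    funext x
    rcases x with x | x
    · rfl
    · exact hs x v
  rw [this]

theorem false : Def A (fun _ : γ → M => False) := ⟨⊥, fun _ => by simp⟩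

theorem imp (hP : Def A P) (hQ : Def A Q) : Def A (fun v => P v → Q v) :=
  let ⟨φ, hφ⟩ := hP
  let ⟨ψ, hψ⟩ := hQ
  ⟨φ.imp ψ, fun v => (imp_congr (hφ v) (hψ v)).trans Language.Formula.realize_imp.symm⟩

theorem not (hP : Def A P) : Def A (fun v => ¬ P v) := hP.imp Def.false

theorem and (hP : Def A P) (hQ : Def A Q) : Def A (fun v => P v ∧ Q v) :=
  (hP.imp hQ.not).not.congr fun v => by tauto

theorem or (hP : Def A P) (hQ : Def A Q) : Def A (fun v => P v ∨ Q v) :=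
  (hP.not.imp hQ).congr fun v => by tauto

theorem iff (hP : Def A P) (hQ : Def A Q) : Def A (fun v => P v ↔ Q v) :=
  ((hP.imp hQ).and (hQ.imp hP)).congr fun v => by tauto

theorem forall_fin {k : ℕ} {P : Fin k → (γ → M) → Prop} (h : ∀ j, Def A (P j)) :
    Def A (fun v => ∀ j, P j v) := by
  induction k with
  | zero => exact Def.false.not.congr fun _ => by simp
  | succ k ih =>
    exact ((h 0).and (ih fun j => h j.succ)).congr fun _ => by rw [Fin.forall_fin_succ]

/-- Quantifies over all parameters of a formula at once; `exists_wStandard` needs this for the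
values `f j (i)`. -/
theorem ex_tuple {β : Type} [Finite β] {P : (γ → M) → (β → M) → Prop}
    (h : Def A (fun v : γ ⊕ β → M => P (fun i => v (Sum.inl i)) (fun i => v (Sum.inr i)))) :
    Def A (fun v => ∃ q, P v q) := by
  obtain ⟨φ, hφ⟩ := h
  refine ⟨(φ.relabel (Equiv.sumAssoc A γ β).symm).iExs β, fun v => ?_⟩
  rw [Language.Formula.realize_iExs]
  refine exists_congr fun q => ?_
  rw [Language.Formula.realize_relabel]
  refine (hφ (Sum.elim v q)).trans (iff_of_eq (congrArg _ ?_))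
  funext x
  rcases x with x | x | x <;> rfl

theorem ex {P : (γ → M) → M → Prop}
    (h : Def A (fun v : γ ⊕ Unit → M => P (fun i => v (Sum.inl i)) (v (Sum.inr ())))) :
    Def A (fun v => ∃ x, P v x) :=
  (ex_tuple (P := fun v q => P v (q ())) h).congr fun _ =>
    ⟨fun ⟨x, hx⟩ => ⟨fun _ => x, hx⟩, fun ⟨q, hq⟩ => ⟨q (), hq⟩⟩

theorem all {P : (γ → M) → M → Prop}
    (h : Def A (fun v : γ ⊕ Unit → M => P (fun i => v (Sum.inl i)) (v (Sum.inr ())))) :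
    Def A (fun v => ∀ x, P v x) :=
  (ex (P := fun v x => ¬ P v x) h.not).not.congr fun _ => by simp

theorem realize {β : Type} {n : ℕ} (φ : memLang.BoundedFormula β n) {p : β → (γ → M) → M}
    {x : Fin n → (γ → M) → M} (hp : ∀ j, IsTerm A (p j)) (hx : ∀ i, IsTerm A (x i)) :
    Def A (fun v => φ.Realize (fun j => p j v) (fun i => x i v)) := by
  have h : Def A (fun v : β ⊕ Fin n → M => φ.Realize (v ∘ Sum.inl) (v ∘ Sum.inr)) := by
    refine ⟨φ.toFormula.relabel Sum.inr, fun v => ?_⟩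
    rw [Language.Formula.realize_relabel, Language.BoundedFormula.realize_toFormula]
    rfl
  exact h.subst (t := Sum.elim p x) (by rintro (j | i); exacts [hp j, hx i])

theorem realize_one {k : ℕ} (φ : MemFormula k 1) {p : Fin k → (γ → M) → M}
    {x : (γ → M) → M} (hp : ∀ j, IsTerm A (p j)) (hx : IsTerm A x) :
    Def A (fun v => φ.Realize (fun j => p j v) ![x v]) :=
  (realize φ hp (x := fun _ => x) fun _ => hx).congr fun v => iff_of_eq (congrArg _ (by
    funext i; fin_cases i; rfl))

theorem realize_two {k : ℕ} (φ : MemFormula k 2) {p : Fin k → (γ → M) → M}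
    {x y : (γ → M) → M} (hp : ∀ j, IsTerm A (p j)) (hx : IsTerm A x) (hy : IsTerm A y) :
    Def A (fun v => φ.Realize (fun j => p j v) ![x v, y v]) :=
  (realize φ hp (x := ![x, y]) fun i => by fin_cases i; exacts [hx, hy]).congr
    fun v => iff_of_eq (congrArg _ (by funext i; fin_cases i <;> rfl))

theorem mem {a b : (γ → M) → M} (ha : IsTerm A a) (hb : IsTerm A b) :
    Def A (fun v => a v ∊ b v) := by
  have h : Def A (fun v : Fin 2 → M => v 0 ∊ v 1) :=
    ⟨memRel.formula₂ (Language.Term.var (Sum.inr 0)) (Language.Term.var (Sum.inr 1)),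
      fun v => by rw [Language.Formula.realize_rel₂]; rfl⟩
  exact h.subst (t := ![a, b]) fun i => by fin_cases i; exacts [ha, hb]

theorem eq {a b : (γ → M) → M} (ha : IsTerm A a) (hb : IsTerm A b) :
    Def A (fun v => a v = b v) := by
  have h : Def A (fun v : Fin 2 → M => v 0 = v 1) :=
    ⟨(Language.Term.var (Sum.inr 0)).equal (Language.Term.var (Sum.inr 1)), fun v => by
      rw [Language.Formula.realize_equal]; rfl⟩
  exact h.subst (t := ![a, b]) fun i => by fin_cases i; exacts [ha, hb]

/-- Only finitely many parameters occur in a formula. -/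
theorem exists_memFormula {n : ℕ} {P : (Fin n → M) → Prop} (h : Def A P) :
    ∃ (k : ℕ) (φ : MemFormula k n) (p : Fin k → M), (∀ j, p j ∈ A) ∧
      ∀ x, P x ↔ φ.Realize p x := by
  classical
  obtain ⟨φ, hφ⟩ := h
  -- The `n` variables become de Bruijn indices, so that only parameters remain free; the finitely
  -- many that occur are then numbered.
  let ψ : memLang.BoundedFormula A n := Language.BoundedFormula.relabel (n := n) (k := 0) id φ
  let e := ψ.freeVarFinset.equivFin
  refine ⟨ψ.freeVarFinset.card, ψ.restrictFreeVar e, fun j => (e.symm j).1.1,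
    fun j => (e.symm j).1.2, fun x => ?_⟩
  rw [hφ, Language.BoundedFormula.realize_restrictFreeVar (Subtype.val : A → M)
    (fun a => by simp)]
  have := Language.BoundedFormula.realize_relabel (m := n) (n := 0) (φ := φ)
    (g := id) (v := (Subtype.val : A → M)) (xs := x)
  refine Iff.trans (iff_of_eq ?_) this.symm
  have hx : (x ∘ Fin.natAdd n : Fin 0 → M) = default := Subsingleton.elim _ _
  rw [hx]
  refine congrArg (fun u => φ.Realize u) (funext ?_)
  rintro (a | i) <;> rfl

/-! ### Set-theoretic notions -/

theorem isUPair {a b c : (γ → M) → M} (ha : IsTerm A a) (hb : IsTerm A b) (hc : IsTerm A c) :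
    Def A (fun v => IsUPair (a v) (b v) (c v)) := by
  have h : Def A (fun v : Fin 3 → M => IsUPair (v 0) (v 1) (v 2)) :=
    all (iff (mem (.var _) (.var _)) (or (eq (.var _) (.var _)) (eq (.var _) (.var _))))
  exact h.subst (t := ![a, b, c]) fun i => by fin_cases i; exacts [ha, hb, hc]

theorem isPair {a b c : (γ → M) → M} (ha : IsTerm A a) (hb : IsTerm A b) (hc : IsTerm A c) :
    Def A (fun v => IsPair (a v) (b v) (c v)) := by
  have h : Def A (fun v : Fin 3 → M => IsPair (v 0) (v 1) (v 2)) :=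
    all (iff (mem (.var _) (.var _)) (or (isUPair (.var _) (.var _) (.var _))
      (isUPair (.var _) (.var _) (.var _))))
  exact h.subst (t := ![a, b, c]) fun i => by fin_cases i; exacts [ha, hb, hc]

theorem mapsTo {a b c : (γ → M) → M} (ha : IsTerm A a) (hb : IsTerm A b) (hc : IsTerm A c) :
    Def A (fun v => MapsTo (a v) (b v) (c v)) := by
  have h : Def A (fun v : Fin 3 → M => MapsTo (v 0) (v 1) (v 2)) :=
    ex (and (mem (.var _) (.var _)) (isPair (.var _) (.var _) (.var _)))
  exact h.subst (t := ![a, b, c]) fun i => by fin_cases i; exacts [ha, hb, hc]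

theorem isFunOn {a b : (γ → M) → M} (ha : IsTerm A a) (hb : IsTerm A b) :
    Def A (fun v => IsFunOn (a v) (b v)) := by
  have h : Def A (fun v : Fin 2 → M => IsFunOn (v 0) (v 1)) :=
    and (all (imp (mem (.var _) (.var _))
        (ex (ex (and (mem (.var _) (.var _)) (isPair (.var _) (.var _) (.var _)))))))
      (all (imp (mem (.var _) (.var _)) (ex (and (mapsTo (.var _) (.var _) (.var _))
        (all (imp (mapsTo (.var _) (.var _) (.var _)) (eq (.var _) (.var _))))))))
  exact h.subst (t := ![a, b]) fun i => by fin_cases i; exacts [ha, hb]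

theorem isNat {a : (γ → M) → M} (ha : IsTerm A a) : Def A (fun v => IsNat (a v)) := by
  have h : Def A (fun v : Fin 1 → M => IsNat (v 0)) :=
    all (imp
      (and (ex (and (all (not (mem (.var _) (.var _)))) (mem (.var _) (.var _))))
        (all (imp (mem (.var _) (.var _)) (ex (and
          (all (iff (mem (.var _) (.var _)) (or (mem (.var _) (.var _)) (eq (.var _) (.var _)))))
          (mem (.var _) (.var _)))))))
      (mem (.var _) (.var _)))
  exact h.subst (t := fun _ => a) fun _ => ha

theorem natLE {a b : (γ → M) → M} (ha : IsTerm A a) (hb : IsTerm A b) :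
    Def A (fun v => NatLE (a v) (b v)) := or (mem ha hb) (eq ha hb)

end Def

end Definability

/-! ### ZFC inside the model: pairs, functions, choice, natural numbers -/

section SetTheory

variable {M : Type*} [StMem M]

namespace IsZFC

theorem separation_def (h : IsZFC M) {P : M → Prop}
    (hP : Def Set.univ (fun v : Fin 1 → M => P (v 0))) (A : M) :
    ∃ B : M, ∀ x, x ∊ B ↔ x ∊ A ∧ P x := by
  obtain ⟨k, φ, p, -, hφ⟩ := hP.exists_memFormula
  obtain ⟨B, hB⟩ := h.separation k φ p A
  exact ⟨B, fun x => by rw [hB, ← hφ]; rfl⟩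

theorem replacement_def (h : IsZFC M) {P : M → M → Prop}
    (hP : Def Set.univ (fun v : Fin 2 → M => P (v 0) (v 1))) (A : M)
    (hfun : ∀ x, x ∊ A → ∀ y z, P x y → P x z → y = z) :
    ∃ B : M, ∀ y, y ∊ B ↔ ∃ x, x ∊ A ∧ P x y := by
  obtain ⟨k, φ, p, -, hφ⟩ := hP.exists_memFormula
  have hφ' : ∀ x y, P x y ↔ φ.Realize p ![x, y] := fun x y => hφ ![x, y]
  obtain ⟨B, hB⟩ := h.replacement k φ p A fun x hx y z hy hz =>
    hfun x hx y z ((hφ' _ _).2 hy) ((hφ' _ _).2 hz)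
  exact ⟨B, fun y => by simp only [hB, hφ']⟩

theorem isUPair_inj {a b a' b' c : M} (h : IsUPair a b c) (h' : IsUPair a' b' c) :
    (a = a' ∧ b = b') ∨ (a = b' ∧ b = a') := by
  have h1 := (h' a).1 ((h a).2 (Or.inl rfl))
  have h2 := (h' b).1 ((h b).2 (Or.inr rfl))
  have h3 := (h a').1 ((h' a').2 (Or.inl rfl))
  have h4 := (h b').1 ((h' b').2 (Or.inr rfl))
  grind

theorem isUPair_unique (h : IsZFC M) {a b c d : M} (hc : IsUPair a b c) (hd : IsUPair a b d) :
    c = d := h.extensionality c d fun z => (hc z).trans (hd z).symm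

theorem exists_isPair (h : IsZFC M) (a b : M) : ∃ c, IsPair a b c := by
  obtain ⟨s, hs⟩ := h.pairing a a
  obtain ⟨t, ht⟩ := h.pairing a b
  obtain ⟨c, hc⟩ := h.pairing s t
  refine ⟨c, fun z => (hc z).trans (or_congr ⟨?_, ?_⟩ ⟨?_, ?_⟩)⟩
  · rintro rfl; exact hs
  · exact fun hz => h.isUPair_unique hz hs
  · rintro rfl; exact ht
  · exact fun hz => h.isUPair_unique hz ht

theorem isPair_unique (h : IsZFC M) {a b c d : M} (hc : IsPair a b c) (hd : IsPair a b d) :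
    c = d := h.extensionality c d fun z => (hc z).trans (hd z).symm

theorem isPair_inj (h : IsZFC M) {a b a' b' c : M} (hc : IsPair a b c) (hc' : IsPair a' b' c) :
    a = a' ∧ b = b' := by
  obtain ⟨s, hs⟩ := h.pairing a a
  obtain ⟨t, ht⟩ := h.pairing a b
  obtain ⟨s', hs'⟩ := h.pairing a' a'
  obtain ⟨t', ht'⟩ := h.pairing a' b'
  have e1 := (hc' s).1 ((hc s).2 (Or.inl hs))
  have e2 := (hc' t).1 ((hc t).2 (Or.inr ht))
  have e3 := (hc t').1 ((hc' t').2 (Or.inr ht'))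
  have f1 := e1.imp (isUPair_inj hs) (isUPair_inj hs)
  have f2 := e2.imp (isUPair_inj ht) (isUPair_inj ht)
  have f3 := e3.imp (isUPair_inj ht') (isUPair_inj ht')
  grind

theorem eq_of_mapsTo {f I a b c : M} (hf : IsFunOn f I) (ha : a ∊ I)
    (hb : MapsTo f a b) (hc : MapsTo f a c) : b = c :=
  (hf.2 a ha).unique hb hc

theorem mem_dom (h : IsZFC M) {f I a b : M} (hf : IsFunOn f I) (hb : MapsTo f a b) : a ∊ I := by
  obtain ⟨c, hc, hab⟩ := hb
  obtain ⟨a', b', ha', hab'⟩ := hf.1 c hc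
  rwa [(h.isPair_inj hab hab').1]

/-- A definable function on a set is a set. -/
theorem exists_fun (h : IsZFC M) {P : M → M → Prop}
    (hP : Def Set.univ (fun v : Fin 2 → M => P (v 0) (v 1))) (I : M)
    (hfun : ∀ i, i ∊ I → ∃! b, P i b) :
    ∃ F, IsFunOn F I ∧ ∀ i b, MapsTo F i b ↔ i ∊ I ∧ P i b := by
  -- Replacement is applied to `i ↦ ⟨i, b⟩`, whose range is the graph.
  have hQ : Def Set.univ (fun v : Fin 2 → M => ∃ b, P (v 0) b ∧ IsPair (v 0) b (v 1)) :=
    .ex (.and (hP.subst (t := ![fun v => v (Sum.inl 0), fun v => v (Sum.inr ())])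
      fun d => by fin_cases d; exacts [.var _, .var _]) (.isPair (.var _) (.var _) (.var _)))
  obtain ⟨F, hF⟩ := h.replacement_def (P := fun i c => ∃ b, P i b ∧ IsPair i b c) hQ I (by
    rintro i hi c d ⟨b, hb, hc⟩ ⟨b', hb', hd⟩
    obtain rfl := (hfun i hi).unique hb hb'
    exact h.isPair_unique hc hd)
  have key : ∀ i b, MapsTo F i b ↔ i ∊ I ∧ P i b := by
    intro i b
    constructor
    · rintro ⟨c, hc, hib⟩
      obtain ⟨i', hi', b', hb', hib'⟩ := (hF c).1 hc
      obtain ⟨rfl, rfl⟩ := h.isPair_inj hib hib'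
      exact ⟨hi', hb'⟩
    · rintro ⟨hi, hb⟩
      obtain ⟨c, hc⟩ := h.exists_isPair i b
      exact ⟨c, (hF c).2 ⟨i, hi, b, hb, hc⟩, hc⟩
  refine ⟨F, ⟨fun c hc => ?_, fun i hi => ?_⟩, key⟩
  · obtain ⟨i, hi, b, -, hib⟩ := (hF c).1 hc
    exact ⟨i, b, hi, hib⟩
  · obtain ⟨b, hb, hu⟩ := hfun i hi
    exact ⟨b, (key i b).2 ⟨hi, hb⟩, fun b' hb' => hu b' ((key i b').1 hb').2⟩

/-- A definable relation with nonempty sections in a set has a choice function. -/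
theorem exists_choice (h : IsZFC M) {R : M → M → Prop}
    (hR : Def Set.univ (fun v : Fin 2 → M => R (v 0) (v 1))) (I Y : M)
    (hne : ∀ i, i ∊ I → ∃ x, x ∊ Y ∧ R i x) :
    ∃ F, IsFunOn F I ∧ ∀ i x, MapsTo F i x → R i x := by
  have hT : Def Set.univ (fun v : Fin 2 → M => ∀ z, z ∊ v 1 ↔ z ∊ Y ∧ R (v 0) z) :=
    .all (.iff (.mem (.var _) (.var _)) (.and (.mem (.var _) (.const (Set.mem_univ Y)))
      (hR.subst (t := ![fun v => v (Sum.inl 0), fun v => v (Sum.inr ())])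
        fun d => by fin_cases d; exacts [.var _, .var _])))
  have hT_unique : ∀ i X X', (∀ z, z ∊ X ↔ z ∊ Y ∧ R i z) → (∀ z, z ∊ X' ↔ z ∊ Y ∧ R i z) →
      X = X' := fun i X X' hX hX' => h.extensionality X X' fun z => (hX z).trans (hX' z).symm
  have hT_exists : ∀ i, ∃ X, ∀ z, z ∊ X ↔ z ∊ Y ∧ R i z := fun i =>
    h.separation_def (P := R i) (hR.subst (t := ![fun _ => i, fun v => v 0])
      fun d => by fin_cases d; exacts [.const (Set.mem_univ _), .var _]) Y
  -- `A` is the set of sections `{z ∈ Y | R i z}`; the required function sends `i` to the value at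
  -- its section of a choice function on `A`.
  obtain ⟨A, hA⟩ := h.replacement_def (P := fun i X => ∀ z, z ∊ X ↔ z ∊ Y ∧ R i z) hT I
    fun i _ => hT_unique i
  obtain ⟨g, hg, hg'⟩ := h.choice A fun X hX => by
    obtain ⟨i, hi, hX⟩ := (hA X).1 hX
    obtain ⟨x, hx⟩ := hne i hi
    exact ⟨x, (hX x).2 hx⟩
  have hP : Def Set.univ (fun v : Fin 2 → M =>
      ∃ X, (∀ z, z ∊ X ↔ z ∊ Y ∧ R (v 0) z) ∧ MapsTo g X (v 1)) :=
    .ex (.and (hT.subst (t := ![fun v => v (Sum.inl 0), fun v => v (Sum.inr ())])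
      fun d => by fin_cases d; exacts [.var _, .var _])
      (.mapsTo (.const (Set.mem_univ g)) (.var _) (.var _)))
  obtain ⟨F, hF, hF'⟩ := h.exists_fun
      (P := fun i b => ∃ X, (∀ z, z ∊ X ↔ z ∊ Y ∧ R i z) ∧ MapsTo g X b) hP I fun i hi => by
    obtain ⟨X, hX⟩ := hT_exists i
    obtain ⟨b, hb, hu⟩ := hg.2 X ((hA X).2 ⟨i, hi, hX⟩)
    refine ⟨b, ⟨X, hX, hb⟩, ?_⟩
    rintro b' ⟨X', hX', hb'⟩
    obtain rfl := hT_unique i X X' hX hX'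
    exact hu b' hb'
  refine ⟨F, hF, fun i x hx => ?_⟩
  obtain ⟨-, X, hX, hgx⟩ := (hF' i x).1 hx
  exact ((hX x).1 (hg' X x hgx)).2

/-! ### Natural numbers -/

theorem isSucc_unique (h : IsZFC M) {x y z : M} (hy : IsSucc x y) (hz : IsSucc x z) : y = z :=
  h.extensionality y z fun u => (hy u).trans (hz u).symm

theorem isEmptySet_unique (h : IsZFC M) {x y : M} (hx : IsEmptySet x) (hy : IsEmptySet y) :
    x = y := h.extensionality x y fun z => iff_of_false (hx z) (hy z)

theorem isNat_empty (h : IsZFC M) {e : M} (he : IsEmptySet e) : IsNat e := by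
  rintro J ⟨⟨e', he', hJ⟩, -⟩
  rwa [h.isEmptySet_unique he he']

theorem isNat_succ (h : IsZFC M) {n s : M} (hn : IsNat n) (hs : IsSucc n s) : IsNat s := by
  intro J hJ
  obtain ⟨y, hy, hyJ⟩ := hJ.2 n (hn J hJ)
  rwa [h.isSucc_unique hs hy]

/-- The naturals satisfying `P` in some inductive set again form an inductive set. Keeping `IsNat`
in its definition makes it available in the successor step. -/
theorem nat_induction (h : IsZFC M) {P : M → Prop}
    (hP : Def Set.univ (fun v : Fin 1 → M => P (v 0)))
    (h0 : ∀ e, IsEmptySet e → P e)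
    (hs : ∀ n s, IsNat n → P n → IsSucc n s → P s) {n : M} (hn : IsNat n) : P n := by
  obtain ⟨J, hJ⟩ := h.infinity
  obtain ⟨K, hK⟩ := h.separation_def (P := fun x => IsNat x ∧ P x) (.and (.isNat (.var _)) hP) J
  refine ((hK n).1 (hn K ⟨?_, fun x hx => ?_⟩)).2.2
  · obtain ⟨e, he, heJ⟩ := hJ.1
    exact ⟨e, he, (hK e).2 ⟨heJ, h.isNat_empty he, h0 e he⟩⟩
  · obtain ⟨hxJ, hxn, hxP⟩ := (hK x).1 hx
    obtain ⟨y, hy, hyJ⟩ := hJ.2 x hxJ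
    exact ⟨y, hy, (hK y).2 ⟨hyJ, h.isNat_succ hxn hy, hs x y hxn hxP hy⟩⟩

theorem nat_transitive (h : IsZFC M) {n : M} (hn : IsNat n) :
    ∀ m, m ∊ n → ∀ k, k ∊ m → k ∊ n := by
  refine h.nat_induction (P := fun n => ∀ m, m ∊ n → ∀ k, k ∊ m → k ∊ n)
    (.all (.imp (.mem (.var _) (.var _)) (.all (.imp (.mem (.var _) (.var _))
      (.mem (.var _) (.var _)))))) (fun e he m hm => (he m hm).elim) ?_ hn
  intro n s _ ih hs m hm k hk
  rcases (hs m).1 hm with hm | rfl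
  · exact (hs k).2 (Or.inl (ih m hm k hk))
  · exact (hs k).2 (Or.inl hk)

theorem natLE_trans (h : IsZFC M) {k m n : M} (hn : IsNat n) (hkm : NatLE k m)
    (hmn : NatLE m n) : NatLE k n := by
  rcases hmn with hmn | rfl
  · rcases hkm with hkm | rfl
    · exact Or.inl (h.nat_transitive hn m hmn k hkm)
    · exact Or.inl hmn
  · exact hkm

theorem natLE_of_isEmptySet (h : IsZFC M) {n e : M} (hn : IsNat n) (he : IsEmptySet e) :
    NatLE e n := by
  refine h.nat_induction (P := fun n => NatLE e n)
    (.natLE (.const (Set.mem_univ _)) (.var _)) (fun e' he' =>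
      Or.inr (h.isEmptySet_unique he he')) ?_ hn
  rintro n s _ ih hs
  exact Or.inl ((hs e).2 ih)

theorem natLE_succ_of_mem (h : IsZFC M) {n : M} (hn : IsNat n) :
    ∀ m, m ∊ n → ∀ s, IsSucc m s → NatLE s n := by
  refine h.nat_induction (P := fun n => ∀ m, m ∊ n → ∀ s, IsSucc m s → NatLE s n)
    (.all (.imp (.mem (.var _) (.var _)) (.all (.imp (.all (.iff (.mem (.var _) (.var _))
      (.or (.mem (.var _) (.var _)) (.eq (.var _) (.var _))))) (.natLE (.var _) (.var _))))))
    (fun e he m hm => (he m hm).elim) ?_ hn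
  intro n t _ ih ht m hm s hs
  rcases (ht m).1 hm with hm | rfl
  · exact Or.inl ((ht s).2 (ih m hm s hs))
  · exact Or.inr (h.isSucc_unique hs ht)

theorem natLE_or_mem (h : IsZFC M) {m n : M} (hm : IsNat m) (hn : IsNat n) :
    NatLE m n ∨ n ∊ m := by
  refine h.nat_induction (P := fun m => NatLE m n ∨ n ∊ m)
    (.or (.natLE (.var _) (.const (Set.mem_univ _))) (.mem (.const (Set.mem_univ _)) (.var _)))
    (fun e he => Or.inl (h.natLE_of_isEmptySet hn he)) ?_ hm
  rintro m s _ ((ih | rfl) | ih) hs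
  · exact Or.inl (h.natLE_succ_of_mem hn m ih s hs)
  · exact Or.inr ((hs m).2 (Or.inr rfl))
  · exact Or.inr ((hs n).2 (Or.inl ih))

theorem isFiniteSet_of_isNat (h : IsZFC M) {n : M} (hn : IsNat n) : IsFiniteSet n := by
  obtain ⟨F, hF, hF'⟩ := h.exists_fun (P := fun i b => b = i) (.eq (.var _) (.var _)) n
    fun i _ => ⟨i, rfl, fun _ hb => hb⟩
  refine ⟨n, F, hn, hF, fun a b hab => ?_, fun b hb => ⟨b, (hF' b b).2 ⟨hb, rfl⟩, fun a ha => ?_⟩⟩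
  · obtain ⟨ha, rfl⟩ := (hF' a b).1 hab
    exact ha
  · exact ((hF' a b).1 ha).2.symm

/-- A definable property of two arguments has a witness that satisfies it on every initial segment
of `{0, …, ν}` on which it has a witness at all. -/
theorem exists_optimal (h : IsZFC M) [Nonempty M] {Q : M → M → Prop}
    (hQ : Def Set.univ (fun v : Fin 2 → M => Q (v 0) (v 1))) {ν : M} (hν : IsNat ν) :
    ∃ x, ∀ n, IsNat n → NatLE n ν → (∃ y, ∀ m, IsNat m → NatLE m n → Q m y) →
      ∀ m, IsNat m → NatLE m n → Q m x := by
  have hQ' : ∀ {γ : Type} (a b : γ), Def Set.univ (fun v : γ → M => Q (v a) (v b)) := fun a b =>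
    hQ.subst (t := ![fun v => v a, fun v => v b]) fun d => by fin_cases d; exacts [.var _, .var _]
  have hseg : ∀ {γ : Type} (a b : γ), Def Set.univ
      (fun v : γ → M => ∀ m, IsNat m → NatLE m (v a) → Q m (v b)) := fun a b =>
    .all (.imp (.isNat (.var _)) (.imp (.natLE (.var _) (.var _)) (hQ' _ _)))
  refine h.nat_induction (P := fun ν => ∃ x, ∀ n, IsNat n → NatLE n ν →
    (∃ y, ∀ m, IsNat m → NatLE m n → Q m y) → ∀ m, IsNat m → NatLE m n → Q m x)
    (.ex (.all (.imp (.isNat (.var _)) (.imp (.natLE (.var _) (.var _))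
      (.imp (.ex (hseg _ _)) (hseg _ _)))))) ?_ ?_ hν
  · intro e he
    by_cases H : ∃ y, ∀ m, IsNat m → NatLE m e → Q m y
    · obtain ⟨y, hy⟩ := H
      refine ⟨y, ?_⟩
      rintro n _ (hn | rfl) _
      · exact (he n hn).elim
      · exact hy
    · refine ⟨Classical.arbitrary M, ?_⟩
      rintro n _ (hn | rfl) hy
      · exact (he n hn).elim
      · exact (H hy).elim
  · rintro ν s hν ⟨x, hx⟩ hs
    -- A witness up to `s` serves all shorter segments; if there is none, nothing is demanded at `s`
    -- and the old `x` suffices.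
    by_cases H : ∃ y, ∀ m, IsNat m → NatLE m s → Q m y
    · obtain ⟨y, hy⟩ := H
      exact ⟨y, fun n _ hns _ m hm hmn => hy m hm (h.natLE_trans (h.isNat_succ hν hs) hmn hns)⟩
    · refine ⟨x, ?_⟩
      rintro n hn (hns | rfl) hy
      · exact hx n hn ((hs n).1 hns) hy
      · exact (H hy).elim

end IsZFC

end SetTheory

/-! ### Standard and `w`-standard witnesses, and the three claims -/

section SetTheory

variable {M : Type*} [StMem M]

theorem Def.mono {A B : Set M} {γ : Type*} {P : (γ → M) → Prop} (h : Def A P) (hAB : A ⊆ B) :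
    Def B P := by
  obtain ⟨φ, hφ⟩ := h
  refine ⟨φ.relabel (Sum.map (Set.inclusion hAB) id), fun v => ?_⟩
  rw [Language.Formula.realize_relabel, hφ]
  refine iff_of_eq (congrArg _ (funext ?_))
  rintro (a | i) <;> rfl

namespace IsBST

variable {I w : M}

theorem exists_standard (hM : IsBST M) {P : M → Prop}
    (hP : Def {x : M | StMem.st x} (fun v : Fin 1 → M => P (v 0))) (h : ∃ x, P x) :
    ∃ x, StMem.st x ∧ P x := by
  obtain ⟨k, φ, p, hp, hφ⟩ := hP.not.exists_memFormula
  by_contra! H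
  obtain ⟨x, hx⟩ := h
  exact (hφ ![x]).2 (hM.transfer k φ p hp (fun y hy => (hφ ![y]).1 (H y hy)) x) hx

/-- ZFC supplies the function, and its description has only standard parameters, so Transfer makes
it standard. -/
theorem exists_standard_fun (hM : IsBST M) {P : M → M → Prop}
    (hP : Def {x : M | StMem.st x} (fun v : Fin 2 → M => P (v 0) (v 1))) (hI : StMem.st I)
    (hfun : ∀ i, i ∊ I → ∃! b, P i b) :
    ∃ F, StMem.st F ∧ IsFunOn F I ∧ ∀ i b, MapsTo F i b ↔ i ∊ I ∧ P i b :=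
  hM.exists_standard (P := fun F => IsFunOn F I ∧ ∀ i b, MapsTo F i b ↔ i ∊ I ∧ P i b)
    (.and (.isFunOn (.var _) (.const hI)) (.all (.all (.iff (.mapsTo (.var _) (.var _) (.var _))
      (.and (.mem (.var _) (.const hI))
        (hP.subst (t := ![fun v => v (Sum.inl (Sum.inr ())), fun v => v (Sum.inr ())])
          fun d => by fin_cases d; exacts [.var _, .var _]))))))
    (hM.exists_fun (hP.mono (Set.subset_univ _)) I hfun)

theorem exists_standard_choice (hM : IsBST M) {R : M → M → Prop}
    (hR : Def {x : M | StMem.st x} (fun v : Fin 2 → M => R (v 0) (v 1))) (hI : StMem.st I)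
    (Y : M) (hne : ∀ i, i ∊ I → ∃ x, x ∊ Y ∧ R i x) :
    ∃ F, StMem.st F ∧ IsFunOn F I ∧ ∀ i x, MapsTo F i x → R i x :=
  hM.exists_standard (P := fun F => IsFunOn F I ∧ ∀ i x, MapsTo F i x → R i x)
    (.and (.isFunOn (.var _) (.const hI)) (.all (.all (.imp (.mapsTo (.var _) (.var _) (.var _))
        (hR.subst (t := ![fun v => v (Sum.inl (Sum.inr ())), fun v => v (Sum.inr ())])
          fun d => by fin_cases d; exacts [.var _, .var _])))))
    (hM.exists_choice (hR.mono (Set.subset_univ _)) I Y hne)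

theorem wStandard_of_st (hM : IsBST M) (hI : StMem.st I) (hw : w ∊ I) {x : M}
    (hx : StMem.st x) : WStandard I w x := by
  obtain ⟨F, hF, hF', h⟩ := hM.exists_standard_fun (P := fun _ b => b = x)
    (.eq (.var _) (.const hx)) hI fun _ _ => ⟨x, rfl, fun _ hb => hb⟩
  exact ⟨F, hF, hF', (h w x).2 ⟨hw, rfl⟩⟩

/-- The witness is bounded by a standard set, so that a standard choice function provides it. -/
theorem exists_wStandard (hM : IsBST M) (hI : StMem.st I) (hw : w ∊ I) {P : M → Prop}
    (hP : Def {x : M | WStandard I w x} (fun v : Fin 1 → M => P (v 0))) (h : ∃ x, P x) :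
    ∃ x, WStandard I w x ∧ P x := by
  obtain ⟨k, φ, p, hp, hφ⟩ := hP.exists_memFormula
  choose f hf hfI hfp using hp
  obtain ⟨x, hx⟩ := h
  obtain ⟨Y, hY, hxY⟩ := hM.boundedness x
  -- Each parameter `p j` becomes the value of `f j` at a variable `i`, leaving only standard
  -- parameters; `i = w` gives back `P`.
  let Q : M → M → Prop := fun i y => ∃ q : Fin k → M, (∀ j, MapsTo (f j) i (q j)) ∧
    φ.Realize q ![y]
  have hQ : ∀ {γ : Type} (a b : γ), Def {x : M | StMem.st x} (fun v : γ → M => Q (v a) (v b)) :=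
    fun a b => .ex_tuple (.and (.forall_fin fun j => .mapsTo (.const (hf j)) (.var _) (.var _))
      (.realize_one φ (fun _ => .var _) (.var _)))
  have hQw : ∀ y, Q w y ↔ P y := by
    refine fun y => ⟨?_, fun hy => ⟨p, hfp, (hφ ![y]).1 hy⟩⟩
    rintro ⟨q, hq, hy⟩
    obtain rfl : q = p := funext fun j => IsZFC.eq_of_mapsTo (hfI j) hw (hq j) (hfp j)
    exact (hφ ![y]).2 hy
  -- The implication keeps the sections nonempty even at indices with no witness in `Y`, where `x`
  -- is a dummy value.
  obtain ⟨F, hF, hFI, hFQ⟩ := hM.exists_standard_choice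
    (R := fun i y => (∃ z, z ∊ Y ∧ Q i z) → Q i y)
    (.imp (.ex (.and (.mem (.var _) (.const hY)) (hQ _ _))) (hQ _ _)) hI Y fun i _ => by
      by_cases H : ∃ z, z ∊ Y ∧ Q i z
      · obtain ⟨z, hz, hQz⟩ := H
        exact ⟨z, hz, fun _ => hQz⟩
      · exact ⟨x, hxY, fun H' => (H H').elim⟩
  obtain ⟨b, hb, -⟩ := hFI.2 w hw
  exact ⟨b, ⟨F, hF, hFI, hb⟩, (hQw b).1 (hFQ w b hb ⟨x, hxY, (hQw x).2 hx⟩)⟩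

theorem wStandard_transfer (hM : IsBST M) (hI : StMem.st I) (hw : w ∊ I) {k : ℕ}
    (φ : MemFormula k 1) (p : Fin k → M) (hp : ∀ j, WStandard I w (p j))
    (h : ∀ x : M, WStandard I w x → φ.Realize p ![x]) (x : M) : φ.Realize p ![x] := by
  by_contra hx
  obtain ⟨y, hy, hy'⟩ := hM.exists_wStandard hI hw (P := fun x => ¬ φ.Realize p ![x])
    (.not (.realize_one φ (fun j => .const (hp j)) (.var _))) ⟨x, hx⟩
  exact hy' (h y hy)

/-- A nonstandard `m ∊ n` would differ from every standard element of `n`. Bounded Idealization for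
`y ∊ n ∧ y ≠ x`, read on the standard finite set `n` itself, would then give an element of `n`
different from all elements of `n`. -/
theorem st_of_mem_nat (hM : IsBST M) {n : M} (hn : IsNat n) (hst : StMem.st n) {m : M}
    (hm : m ∊ n) : StMem.st m := by
  by_contra hm'
  have hD : Def (Set.univ : Set M) (fun v : Fin 2 → M => v 1 ∊ n ∧ v 1 ≠ v 0) :=
    .and (.mem (.var _) (.const (Set.mem_univ _))) (.not (.eq (.var _) (.var _)))
  obtain ⟨k, φ, p, -, hφ⟩ := hD.exists_memFormula
  obtain ⟨y, hy⟩ := (hM.boundedIdealization k φ p n hst).2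
    ⟨m, fun x hx _ => (hφ ![x, m]).1 ⟨hm, fun e => hm' ((show m = x from e) ▸ hx)⟩⟩ n hst
    (hM.isFiniteSet_of_isNat hn) fun _ hz => hz
  exact ((hφ ![y, y]).2 (hy y ((hφ ![m, y]).2 (hy m hm)).1)).2 rfl

theorem st_of_natLE (hM : IsBST M) {n : M} (hn : IsNat n) (hst : StMem.st n) {m : M}
    (hm : NatLE m n) : StMem.st m := by
  rcases hm with hm | rfl
  · exact hM.st_of_mem_nat hn hst hm
  · exact hst

theorem countableIdealization_wStandard (hM : IsBST M) (hI : StMem.st I) (hw : w ∊ I)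
    (hgood : IsGood I w) {k : ℕ} (φ : MemFormula k 2) (p : Fin k → M)
    (hp : ∀ j, WStandard I w (p j)) :
    (∀ n : M, StMem.st n → IsNat n → ∃ x, ∀ m, IsNat m → NatLE m n → φ.Realize p ![m, x]) ↔
      ∃ x, WStandard I w x ∧ ∀ n, StMem.st n → IsNat n → φ.Realize p ![n, x] := by
  constructor
  · intro H
    obtain ⟨ν, hν, hνw, hν'⟩ := hgood
    have : Nonempty M := ⟨w⟩
    -- Optimality up to `ν` is an `∈`-property with parameters `ν` and `p`, all `w`-standard. The
    -- hypothesis on standard `n` cannot be put into such a formula, hence the detour.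
    obtain ⟨x, hx, hxφ⟩ := hM.exists_wStandard hI hw
      (P := fun x => ∀ n, IsNat n → NatLE n ν →
        (∃ y, ∀ m, IsNat m → NatLE m n → φ.Realize p ![m, y]) →
        ∀ m, IsNat m → NatLE m n → φ.Realize p ![m, x])
      (.all (.imp (.isNat (.var _)) (.imp (.natLE (.var _) (.const hνw)) (.imp
        (.ex (.all (.imp (.isNat (.var _)) (.imp (.natLE (.var _) (.var _))
          (.realize_two φ (fun j => .const (hp j)) (.var _) (.var _))))))
        (.all (.imp (.isNat (.var _)) (.imp (.natLE (.var _) (.var _))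
          (.realize_two φ (fun j => .const (hp j)) (.var _) (.var _)))))))))
      (hM.exists_optimal (Q := fun m x => φ.Realize p ![m, x])
        (.realize_two φ (fun j => .const (Set.mem_univ _)) (.var _) (.var _)) hν)
    refine ⟨x, hx, fun n hst hn => hxφ n hn ?_ (H n hst hn) n hn (Or.inr rfl)⟩
    exact (hM.natLE_or_mem hn hν).resolve_right fun h => hν' (hM.st_of_mem_nat hn hst h)
  · rintro ⟨x, -, hx⟩ n hst hn
    exact ⟨x, fun m hm hmn => hx m (hM.st_of_natLE hn hst hmn) hm⟩

theorem representability (hM : IsBST M) {k : ℕ}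
    (φ : MemFormula k 1) (p : Fin k → M) (hp : ∀ j, StMem.st (p j)) {J : M} (hJ : StMem.st J)
    (hwJ : w ∊ J) {x : M} (hx : WStandard I w x) (hφ : φ.Realize p ![x]) :
    ∃ f, StMem.st f ∧ IsFunOn f J ∧ MapsTo f w x ∧
      ∀ i y, i ∊ J → MapsTo f i y → φ.Realize p ![y] := by
  obtain ⟨f, hf, hfI, hfx⟩ := hx
  obtain ⟨c, hc, hcφ⟩ := hM.exists_standard (P := fun x => φ.Realize p ![x])
    (.realize_one φ (fun j => .const (hp j)) (.var _)) ⟨x, hφ⟩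
  -- `F` keeps the good values of `f` and equals `c` elsewhere, including at points of `J` outside
  -- `I`.
  obtain ⟨F, hF, hFJ, hF'⟩ := hM.exists_standard_fun
    (P := fun i b => (MapsTo f i b ∧ φ.Realize p ![b]) ∨
      (b = c ∧ ¬ ∃ z, MapsTo f i z ∧ φ.Realize p ![z]))
    (.or (.and (.mapsTo (.const hf) (.var _) (.var _))
        (.realize_one φ (fun j => .const (hp j)) (.var _)))
      (.and (.eq (.var _) (.const hc)) (.not (.ex (.and (.mapsTo (.const hf) (.var _) (.var _))
        (.realize_one φ (fun j => .const (hp j)) (.var _))))))) hJ fun i _ => by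
      by_cases H : ∃ z, MapsTo f i z ∧ φ.Realize p ![z]
      · obtain ⟨z, hz, hzφ⟩ := H
        refine ⟨z, Or.inl ⟨hz, hzφ⟩, ?_⟩
        rintro b (⟨hb, -⟩ | ⟨-, hb⟩)
        · exact IsZFC.eq_of_mapsTo hfI (hM.mem_dom hfI hz) hb hz
        · exact (hb ⟨z, hz, hzφ⟩).elim
      · refine ⟨c, Or.inr ⟨rfl, H⟩, ?_⟩
        rintro b (hb | ⟨rfl, -⟩)
        · exact (H ⟨b, hb⟩).elim
        · rfl
  refine ⟨F, hF, hFJ, (hF' w x).2 ⟨hwJ, Or.inl ⟨hfx, hφ⟩⟩, fun i y _ hy => ?_⟩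
  rcases ((hF' i y).1 hy).2 with ⟨-, h⟩ | ⟨rfl, -⟩
  · exact h
  · exact hcφ

/-! ### The universe of `w`-standard sets -/

/-- The inclusion of the universe of `w`-standard sets. -/
def subUniverseEmbedding (I w : M) : SubUniverse I w ↪[memLang] M where
  toFun := Subtype.val
  inj' := Subtype.val_injective
  map_fun' f := f.elim
  map_rel' r _ := by cases r; exact Iff.rfl

theorem exists_elementary (hM : IsBST M) (hI : StMem.st I) (hw : w ∊ I) :
    ∃ f : SubUniverse I w ↪ₑ[memLang] M, ∀ x, f x = x.1 := by
  refine ⟨(subUniverseEmbedding I w).toElementaryEmbedding fun n φ x a ha => ?_, fun _ => rfl⟩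
  -- In the Tarski–Vaught test the first `n` arguments are `w`-standard parameters and only the last
  -- is a variable.
  let t : Fin (n + 1) → (Fin 1 → M) → M := fun i v =>
    (Fin.snoc (subUniverseEmbedding I w ∘ x) (v 0) : Fin (n + 1) → M) i
  have ht : ∀ i, IsTerm {x : M | WStandard I w x} (t i) := fun i => by
    induction i using Fin.lastCases with
    | last => exact ⟨Sum.inr 0, fun v => Fin.snoc_last (α := fun _ => M) _ _⟩
    | cast i => exact ⟨Sum.inl (x i), fun v => Fin.snoc_castSucc (α := fun _ => M) _ _ _⟩
  obtain ⟨b, hb, hbφ⟩ := hM.exists_wStandard hI hw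
    (P := fun b => φ.Realize default (Fin.snoc (subUniverseEmbedding I w ∘ x) b : _ → M))
    ((Def.realize φ (p := fun j => j.elim) (fun j => j.elim) ht).congr fun _ =>
      iff_of_eq (congrArg₂ _ (Subsingleton.elim _ _) rfl)) ⟨a, ha⟩
  exact ⟨⟨b, hb⟩, hbφ⟩

end IsBST

open Language in
/-- `IsNat` as a formula. -/
def isNatFormula : memLang.Formula (Fin 1) :=
  ∀' (((∃' ((∀' ∼(memRel.boundedFormula₂ (&2) (&1))) ⊓ memRel.boundedFormula₂ (&1) (&0))) ⊓
    (∀' (memRel.boundedFormula₂ (&1) (&0) ⟹ ∃' ((∀' (memRel.boundedFormula₂ (&3) (&2) ⇔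
      (memRel.boundedFormula₂ (&3) (&1) ⊔ (&3) =' (&1)))) ⊓
        memRel.boundedFormula₂ (&2) (&0))))) ⟹
    memRel.boundedFormula₂ (Term.var (Sum.inl 0)) (&0))

theorem relMap_memRel {a b : M} :
    Language.Structure.RelMap memRel ![a, b] ↔ a ∊ b := Iff.rfl

theorem realize_isNatFormula (v : Fin 1 → M) : isNatFormula.Realize v ↔ IsNat (v 0) := by
  simp [isNatFormula, Language.Formula.Realize, Language.BoundedFormula.realize_rel₂,
    relMap_memRel, Fin.snoc, IsNat, IsInductive, IsSucc, IsEmptySet]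

namespace IsBST

variable {I w : M}

/-- On the left the inductive sets range only over `w`-standard ones, so an explicit formula and
elementarity are needed. -/
theorem isNat_subUniverse (hM : IsBST M) (hI : StMem.st I) (hw : w ∊ I) (n : SubUniverse I w) :
    IsNat n ↔ IsNat n.1 := by
  obtain ⟨f, hf⟩ := hM.exists_elementary hI hw
  have := f.map_formula isNatFormula fun _ => n
  rw [realize_isNatFormula, realize_isNatFormula] at this
  exact this.symm.trans (iff_of_eq (congrArg IsNat (hf n)))

theorem natLE_subUniverse (m n : SubUniverse I w) : NatLE m n ↔ NatLE m.1 n.1 :=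
  or_congr Iff.rfl Subtype.ext_iff

theorem countableIdealization_subUniverse (hM : IsBST M) (hI : StMem.st I) (hw : w ∊ I)
    (hgood : IsGood I w) : CountableIdealization (SubUniverse I w) := by
  intro k φ p
  obtain ⟨f, hf⟩ := hM.exists_elementary hI hw
  have hφ : ∀ m x : SubUniverse I w,
      φ.Realize p ![m, x] ↔ φ.Realize (fun j => (p j).1) ![m.1, x.1] := fun m x => by
    rw [← f.map_boundedFormula φ p ![m, x] ]
    refine iff_of_eq (congrArg₂ _ (funext fun j => hf _) (funext fun i => ?_))
    fin_cases i
    · exact hf m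
    · exact hf x
  constructor
  · intro H
    obtain ⟨x, hxw, hx⟩ := (hM.countableIdealization_wStandard hI hw hgood φ (fun j => (p j).1)
      fun j => (p j).2).1 fun n hst hn => by
        obtain ⟨x, hx⟩ := H ⟨n, hM.wStandard_of_st hI hw hst⟩ hst
          ((hM.isNat_subUniverse hI hw _).2 hn)
        refine ⟨x.1, fun m hm hmn => ?_⟩
        -- The hypothesis `H` speaks only of `w`-standard `m`, but every `m` below a standard `n` is
        -- standard.
        let m' : SubUniverse I w := ⟨m, hM.wStandard_of_st hI hw (hM.st_of_natLE hn hst hmn)⟩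
        exact (hφ m' x).1 (hx m' ((hM.isNat_subUniverse hI hw m').2 hm)
          ((natLE_subUniverse _ _).2 hmn))
    exact ⟨⟨x, hxw⟩, fun n hst hn => (hφ _ _).2
      (hx n.1 hst ((hM.isNat_subUniverse hI hw n).1 hn))⟩
  · rintro ⟨x, hx⟩ n hst hn
    exact ⟨x, fun m hm hmn => hx m (hM.st_of_natLE ((hM.isNat_subUniverse hI hw n).1 hn) hst
      ((natLE_subUniverse _ _).1 hmn)) hm⟩

end IsBST

end SetTheory

end BST

theorem mainTheorem3 {M : Type*} [BST.StMem M] (hM : BST.IsBST M)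
    (w I : M) (hI : BST.StMem.st I) (hw : w ∊ I) :
    -- (1) Transfer from `w`-standard sets
    (∀ (k : ℕ) (φ : BST.MemFormula k 1) (p : Fin k → M), (∀ j, BST.WStandard I w (p j)) →
      (∀ x : M, BST.WStandard I w x → φ.Realize p ![x]) → ∀ x : M, φ.Realize p ![x]) ∧
    -- (2) Countable Idealization into `w`-standard sets
    (BST.IsGood I w →
      (∀ (k : ℕ) (φ : BST.MemFormula k 2) (p : Fin k → M), (∀ j, BST.WStandard I w (p j)) →
        ((∀ n : M, BST.StMem.st n → BST.IsNat n →
            ∃ x, ∀ m, BST.IsNat m → BST.NatLE m n → φ.Realize p ![m, x]) ↔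
          ∃ x, BST.WStandard I w x ∧
            ∀ n, BST.StMem.st n → BST.IsNat n → φ.Realize p ![n, x])) ∧
      BST.CountableIdealization (BST.SubUniverse I w)) ∧
    -- (3) Representability, over every standard set `J` that contains `w`
    (∀ (k : ℕ) (φ : BST.MemFormula k 1) (p : Fin k → M), (∀ j, BST.StMem.st (p j)) →
      ∀ J : M, BST.StMem.st J → w ∊ J →
      ∀ x : M, BST.WStandard I w x → φ.Realize p ![x] →
        ∃ f, BST.StMem.st f ∧ BST.IsFunOn f J ∧ BST.MapsTo f w x ∧
          ∀ i y, i ∊ J → BST.MapsTo f i y → φ.Realize p ![y]) :=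
  ⟨fun _ φ p hp h => hM.wStandard_transfer hI hw φ p hp h,
    fun hgood => ⟨fun _ φ p hp => hM.countableIdealization_wStandard hI hw hgood φ p hp,
      hM.countableIdealization_subUniverse hI hw hgood⟩,
    fun _ φ p hp _ hJ hwJ _ hx hφ => hM.representability φ p hp hJ hwJ hx hφ⟩
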